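/- Consider the critical Galton--Watson branching process, started by a single progenitor, in which every individual independently has $0$ or $2$ (ordered) children with probabilities $p_0=p_2=1/2$. It terminates almost surely, and its terminal tree is a finite rooted binary tree in which the two children of every non-leaf vertex are ordered. For $n\ge 1$ let $T_n$ be this terminal tree conditioned on having exactly $n$ leaves, the leaves being then labelled bijectively by the elements of $[n]=\{1,\dots,n\}$ uniformly at random. (Equivalently, $T_n$ is a uniformly random ordered binary tree with $n$ leaves, with uniformly random leaf labels.) For a nonempty $S\subseteq[n]$, the tree induced by $S$ in a binary tree $T$ with leaf-set $[n]$ is the ordered binary tree with leaf-set $S$ obtained from the subtree formed by the paths from the lowest common ancestor of $S$ to the leaves in $S$ by suppressing its non-root vertices of degree two, the order of children being inherited from $T$. Let $T_n',T_n''$ be two independent copies of $T_n$. For $a\ge 1$ let $X_{n,a}$ be the number of sets $S\subseteq[n]$ with $|S|=a$ that induce the same (ordered, leaf-labelled) tree in $T_n'$ and in $T_n''$, and let $\mathrm{MAST}(T_n',T_n'')$ be the largest cardinality of a set $S\subseteq[n]$ that induces the same tree in $T_n'$ and in $T_n''$. Then, for all $n\ge 1$ and $a\ge 1$, $$\mathbb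 E[X_{n,a}]=\binom{n}{a}\,\frac{1}{2^{a-1}(2a-3)!!}\qquad(\text{with }(-1)!!:=1);$$ in particular $$\mathbb E[X_{n,1}]=n,\qquad \mathbb E[X_{n,2}]=\frac{n(n-1)}{4},\qquad \mathbb E[X_{n,3}]=\frac{n(n-1)(n-2)}{72}.$$ Consequently, a maximum agreement subtree has at most $(1+o(1))\frac e2 n^{1/2}$ leaves with high probability: there is a sequence $\delta_n\to 0$ such that $$\mathbb P\Bigl(\mathrm{MAST}(T_n',T_n'')\le(1+\delta_n)\frac e2\,n^{1/2}\Bigr)\to 1\qquad(n\to\infty).$$ -/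

import Mathlib

open MeasureTheory ProbabilityTheory Filter Topology
open scoped Nat

/-- Finite rooted binary trees in which every non-leaf vertex has two ordered children (a left one
and a right one) and every leaf carries a label from `α`.  `OrdTree Unit` is the type of unlabelled
ordered binary trees. -/
inductive OrdTree (α : Type) : Type where
  | leaf (a : α) : OrdTree α
  | node (l r : OrdTree α) : OrdTree α

namespace OrdTree

/-- The list of the leaf labels, read from left to right. -/
def labels {α : Type} : OrdTree α → List α
  | leaf a => [a]
  | node l r => l.labels ++ r.labels

/-- The number of leaves. -/
def numLeaves {α : Type} : OrdTree α → ℕ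
  | leaf _ => 1
  | node l r => l.numLeaves + r.numLeaves

/-- The underlying unlabelled ordered tree. -/
def shape {α : Type} : OrdTree α → OrdTree Unit
  | leaf _ => leaf ()
  | node l r => node l.shape r.shape

/-- The (ordered, leaf-labelled) tree induced by the set `S` of labels in a tree.  Only the vertices
lying on paths to leaves with labels in `S` are kept.  A vertex both of whose children are kept
stays as a branching vertex, with the order of its children unchanged; a vertex with exactly one
child kept is ignored: it is either a vertex of total degree two of the lowest common ancestor tree
of `S`, or lies above the lowest common ancestor of `S`.  The value is `none` if no leaf has its
label in `S`. -/
def induced {α : Type} [DecidableEq α] (S : Finset α) : OrdTree α → Option (OrdTree α)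
  | leaf a => if a ∈ S then some (leaf a) else none
  | node l r =>
    match l.induced S, r.induced S with
    | some l', some r' => some (node l' r')
    | some l', none => some l'
    | none, some r' => some r'
    | none, none => none

/-- All sets of trees are measurable (the trees with labels in a countable set are countable). -/
instance instMeasurableSpace {α : Type} : MeasurableSpace (OrdTree α) := ⊤

end OrdTree

namespace GaltonWatson

/-- The offspring distribution `p₀ = p₂ = 1/2`. -/
noncomputable def offspring : PMF ℕ := PMF.uniformOfFinset {0, 2} ⟨0, by simp⟩

/-- The Galton–Watson process: the potential individuals are the finite words over `ℕ`, the empty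
word being the progenitor and `v ++ [i]` being the `i`-th child of `v`; the numbers of children
`ξ v` are independent with the common law `offspring`. -/
noncomputable def process : Measure (List ℕ → ℕ) :=
  Measure.infinitePi fun _ : List ℕ => offspring.toMeasure

/-- `IsTerminalTree ξ v t`: the family tree of the individual `v` and its descendants is finite,
and is equal to `t`, if `ξ` gives the numbers of children. -/
def IsTerminalTree (ξ : List ℕ → ℕ) : List ℕ → OrdTree Unit → Prop
  | v, .leaf _ => ξ v = 0
  | v, .node l r => ξ v = 2 ∧ IsTerminalTree ξ (v ++ [0]) l ∧ IsTerminalTree ξ (v ++ [1]) r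

/-- The law of the terminal tree: the mass of a finite tree `t` is the probability that the family
tree of the progenitor is `t`. -/
noncomputable def terminalLaw : Measure (OrdTree Unit) :=
  Measure.sum fun t => process {ξ | IsTerminalTree ξ [] t} • Measure.dirac t

/-- The trees of shape `t` whose leaves are bijectively labelled by the `n` elements of `Fin n`. -/
def labellings (n : ℕ) (t : OrdTree Unit) : Set (OrdTree (Fin n)) :=
  {T | T.shape = t ∧ T.labels.Nodup ∧ ∀ i, i ∈ T.labels}

/-- The law of `T_n`: the terminal tree is conditioned on having `n` leaves, and then its leaves are
labelled by the elements of `Fin n` uniformly at random. -/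
noncomputable def treeLaw (n : ℕ) : Measure (OrdTree (Fin n)) :=
  (cond terminalLaw {t | t.numLeaves = n}).bind fun t => uniformOn (labellings n t)

/-- The joint law of two independent copies of `T_n`. -/
noncomputable def pairLaw (n : ℕ) : Measure (OrdTree (Fin n) × OrdTree (Fin n)) :=
  (treeLaw n).prod (treeLaw n)

open Classical in
/-- The leaf-sets that induce the same tree in both trees of a pair. -/
noncomputable def agreementSets {n : ℕ} (T : OrdTree (Fin n) × OrdTree (Fin n)) :
    Finset (Finset (Fin n)) :=
  Finset.univ.filter fun S => T.1.induced S = T.2.induced S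

/-- `X_{n,a}`: the number of the leaf-sets of cardinality `a` that induce the same tree in both trees
of a pair. -/
noncomputable def numAgreement {n : ℕ} (a : ℕ) (T : OrdTree (Fin n) × OrdTree (Fin n)) : ℕ :=
  ((agreementSets T).filter fun S => S.card = a).card

/-- The number of leaves of a maximum agreement subtree of a pair of trees. -/
noncomputable def mast {n : ℕ} (T : OrdTree (Fin n) × OrdTree (Fin n)) : ℕ :=
  (agreementSets T).sup Finset.card

end GaltonWatson

/-! A terminal tree with `n` leaves has `2n - 1` vertices, each contributing a factor 1/2, so all
shapes with `n` leaves are equally likely. Every shape has the same number of labellings, hence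
`T_n` is uniform on the labelled ordered trees (`treeLaw_eq`). A new leaf can be attached to a tree
with `a` leaves in `4a - 2` ways: at any of its `2a - 1` vertices, on either side. This count does
not depend on the tree, and attachment inverts deletion (`mem_inserts_iff`), so all fibres of the
restriction to `S` have equal size (`card_fiber_mul`). Thus the tree induced by `S` is uniform, and
two independent copies agree on `S` with probability `1 / treeCount S.card`. Linearity gives the
expectation. For the tail, a union bound over large `S` reduces to bounding `n.choose a / treeCount
a`, which is at most `4n * n ^ a / (2a)!`. Since `(2a)! ≥ (2a/e) ^ (2a)`, this is tiny once `2a`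
exceeds `e * √n` by a factor `1 + n ^ (-1/4)`. -/

namespace OrdTree

/-! ### Leaf counts and countability. -/

variable {α : Type}

theorem length_labels (t : OrdTree α) : t.labels.length = t.numLeaves := by
  induction t with
  | leaf a => rfl
  | node l r hl hr => simp [labels, numLeaves, hl, hr]

theorem numLeaves_pos (t : OrdTree α) : 0 < t.numLeaves := by
  induction t with
  | leaf a => exact Nat.one_pos
  | node l r hl hr => simp only [numLeaves]; omega

theorem numLeaves_shape (t : OrdTree α) : t.shape.numLeaves = t.numLeaves := by
  induction t with
  | leaf a => rfl
  | node l r hl hr => simp [shape, numLeaves, hl, hr]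

theorem finite_numLeaves_eq [Finite α] (k : ℕ) : {t : OrdTree α | t.numLeaves = k}.Finite := by
  induction k using Nat.strong_induction_on with
  | _ k ih =>
    have hfin : (Set.range (leaf : α → OrdTree α) ∪ ⋃ i ∈ Set.Iio k, ⋃ j ∈ Set.Iio k,
        Set.image2 node {t : OrdTree α | t.numLeaves = i} {t | t.numLeaves = j}).Finite :=
      (Set.finite_range _).union ((Set.finite_Iio k).biUnion fun i hi =>
        (Set.finite_Iio k).biUnion fun j hj => (ih i hi).image2 _ (ih j hj))
    refine hfin.subset fun t ht => ?_
    cases t with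
    | leaf a => exact Or.inl ⟨a, rfl⟩
    | node l r =>
      have := l.numLeaves_pos
      have := r.numLeaves_pos
      simp only [Set.mem_ofPred_eq, numLeaves] at ht
      refine Or.inr ?_
      simp only [Set.mem_iUnion]
      exact ⟨l.numLeaves, by simp; omega, r.numLeaves, by simp; omega, l, rfl, r, rfl, rfl⟩

/-- There are finitely many trees of each size. Countability makes the product σ-algebra on pairs of
trees discrete, so measurability is automatic later. -/
instance instCountable [Finite α] : Countable (OrdTree α) := by
  have h : (⋃ k, {t : OrdTree α | t.numLeaves = k}).Countable :=
    Set.countable_iUnion fun k => (finite_numLeaves_eq k).countable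
  refine Set.countable_univ_iff.1 (h.mono fun t _ => ?_)
  exact Set.mem_iUnion.2 ⟨t.numLeaves, rfl⟩

instance instDiscreteMeasurableSpace : DiscreteMeasurableSpace (OrdTree α) :=
  ⟨fun _ => trivial⟩

/-! ### Induced subtrees. -/

section Induced

variable [DecidableEq α]

theorem induced_eq_none_iff {S : Finset α} {t : OrdTree α} :
    t.induced S = none ↔ ∀ y ∈ t.labels, y ∉ S := by
  induction t with
  | leaf a => simp [induced, labels]
  | node l r hl hr =>
    simp only [labels, List.mem_append, or_imp, forall_and, ← hl, ← hr, induced]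
    cases l.induced S <;> cases r.induced S <;> simp

theorem induced_eq_self {S : Finset α} {t : OrdTree α} (h : ∀ y ∈ t.labels, y ∈ S) :
    t.induced S = some t := by
  induction t with
  | leaf a => simpa [induced, labels] using h
  | node l r hl hr =>
    simp only [labels, List.mem_append, or_imp, forall_and] at h
    simp [induced, hl h.1, hr h.2]

theorem labels_of_induced_eq_some {S : Finset α} {t s : OrdTree α} (h : t.induced S = some s) :
    s.labels = t.labels.filter (· ∈ S) := by
  induction t generalizing s with
  | leaf a =>
    by_cases ha : a ∈ S <;> simp [induced, ha] at h
    subst h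
    simp [labels, ha]
  | node l r hl hr =>
    have key : ∀ u : OrdTree α, u.induced S = none → u.labels.filter (· ∈ S) = [] := fun u hu => by
      simpa using induced_eq_none_iff.1 hu
    simp only [labels, List.filter_append]
    rcases hl' : l.induced S with _ | l' <;> rcases hr' : r.induced S with _ | r' <;>
      simp only [induced, hl', hr', Option.some.injEq, reduceCtorEq] at h <;> subst h
    · rw [key l hl', hr hr', List.nil_append]
    · rw [key r hr', hl hl', List.append_nil]
    · rw [labels, hl hl', hr hr']

/-- Restriction is functorial, so leaves outside `S` may be deleted one at a time. -/
theorem induced_bind {S A : Finset α} (hSA : S ⊆ A) (t : OrdTree α) :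
    (t.induced A).bind (·.induced S) = t.induced S := by
  induction t with
  | leaf a =>
    by_cases ha : a ∈ A
    · simp [induced, ha]
    · have haS : a ∉ S := fun h => ha (hSA h)
      simp [induced, ha, haS]
  | node l r hl hr =>
    simp only [induced]
    rcases hl' : l.induced A with _ | l' <;> rcases hr' : r.induced A with _ | r' <;>
      simp only [hl', hr', Option.bind_none, Option.bind_some] at hl hr ⊢ <;>
      simp only [induced, ← hl, ← hr]
    · cases r'.induced S <;> rfl
    · cases l'.induced S <;> rfl

end Induced

/-! ### Attaching and deleting one leaf. -/

open Classical in
/-- The trees obtained from a tree by attaching a new leaf `x`, on either side, at some vertex. -/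
noncomputable def inserts (x : α) : OrdTree α → Finset (OrdTree α)
  | leaf a => {node (leaf x) (leaf a), node (leaf a) (leaf x)}
  | node l r => {node (leaf x) (node l r), node (node l r) (leaf x)} ∪
      ((inserts x l).image (node · r) ∪ (inserts x r).image (node l))

theorem node_leaf_mem_inserts (x : α) (t : OrdTree α) : node t (leaf x) ∈ inserts x t := by
  cases t <;> simp [inserts]

theorem leaf_node_mem_inserts (x : α) (t : OrdTree α) : node (leaf x) t ∈ inserts x t := by
  cases t <;> simp [inserts]

theorem node_mem_inserts_left {x : α} {l l' : OrdTree α} (r : OrdTree α) (h : l' ∈ inserts x l) :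
    node l' r ∈ inserts x (node l r) := by
  simp [inserts, h]

theorem node_mem_inserts_right {x : α} {r r' : OrdTree α} (l : OrdTree α) (h : r' ∈ inserts x r) :
    node l r' ∈ inserts x (node l r) := by
  simp [inserts, h]

theorem labels_perm_of_mem_inserts {x : α} {s t : OrdTree α} (h : t ∈ inserts x s) :
    t.labels.Perm (x :: s.labels) := by
  induction s generalizing t with
  | leaf a =>
    simp only [inserts, Finset.mem_insert, Finset.mem_singleton] at h
    rcases h with rfl | rfl
    · exact List.Perm.refl _
    · exact List.Perm.swap _ _ _
  | node l r hl hr =>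
    simp only [inserts, Finset.mem_union, Finset.mem_insert, Finset.mem_singleton,
      Finset.mem_image] at h
    rcases h with (rfl | rfl) | (⟨l', hl', rfl⟩ | ⟨r', hr', rfl⟩)
    · exact List.Perm.refl _
    · exact List.perm_append_singleton _ _
    · exact (hl hl').append_right _
    · exact ((hr hr').append_left _).trans List.perm_middle

theorem numLeaves_of_mem_inserts {x : α} {s t : OrdTree α} (h : t ∈ inserts x s) :
    t.numLeaves = s.numLeaves + 1 := by
  simpa [length_labels] using (labels_perm_of_mem_inserts h).length_eq

theorem card_inserts {x : α} {s : OrdTree α} (hx : x ∉ s.labels) :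
    (inserts x s).card = 4 * s.numLeaves - 2 := by
  classical
  induction s with
  | leaf a =>
    simp only [labels, List.mem_singleton] at hx
    simp [inserts, numLeaves, hx]
  | node l r hl hr =>
    simp only [labels, List.mem_append, not_or] at hx
    have hlpos := l.numLeaves_pos
    have hrpos := r.numLeaves_pos
    have hnum : ∀ u v : OrdTree α, u = v → u.numLeaves = v.numLeaves := fun _ _ h => h ▸ rfl
    have hleaf : ∀ u : OrdTree α, leaf x = u → x ∈ u.labels := by
      rintro _ rfl; simp [labels]
    -- Attaching inside `l` enlarges the left child; attaching inside `r` leaves it unchanged.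
    have h1 : Disjoint ((inserts x l).image (node · r)) ((inserts x r).image (node l)) := by
      rw [Finset.disjoint_left]
      rintro t ht ht'
      simp only [Finset.mem_image] at ht ht'
      obtain ⟨l', hl', rfl⟩ := ht
      obtain ⟨r', hr', he⟩ := ht'
      simp only [node.injEq] at he
      have := hnum _ _ he.1
      have := numLeaves_of_mem_inserts hl'
      omega
    -- An attachment at the root equal to one further down would force a tree to be its own child,
    -- or `x` to be a label already.
    have h2 : Disjoint ({node (leaf x) (node l r), node (node l r) (leaf x)} : Finset (OrdTree α))
        ((inserts x l).image (node · r) ∪ (inserts x r).image (node l)) := by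
      rw [Finset.disjoint_left]
      rintro t ht ht'
      simp only [Finset.mem_union, Finset.mem_image, Finset.mem_insert, Finset.mem_singleton]
        at ht ht'
      rcases ht with rfl | rfl <;> rcases ht' with ⟨u, hu, he⟩ | ⟨u, hu, he⟩ <;>
        simp only [node.injEq] at he
      · have := hnum _ _ he.2
        simp only [numLeaves] at this
        omega
      · exact hx.1 (hleaf _ he.1.symm)
      · exact hx.2 (hleaf _ he.2.symm)
      · have := hnum _ _ he.1
        simp only [numLeaves] at this
        omega
    have h3 : node (leaf x) (node l r) ≠ node (node l r) (leaf x) := by simp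
    rw [inserts, Finset.card_union_of_disjoint h2, Finset.card_union_of_disjoint h1,
      Finset.card_pair h3, Finset.card_image_of_injective _ fun u v h => by simpa using h,
      Finset.card_image_of_injective _ fun u v h => by simpa using h, hl hx.1, hr hx.2, numLeaves]
    omega

variable [DecidableEq α]

theorem induced_of_mem_inserts {x : α} {s t : OrdTree α} {A : Finset α} (hx : x ∉ A)
    (hs : ∀ y ∈ s.labels, y ∈ A) (h : t ∈ inserts x s) : t.induced A = some s := by
  have hleaf : (leaf x).induced A = none := by simp [induced, hx]
  induction s generalizing t with
  | leaf a =>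
    have hself := induced_eq_self hs
    simp only [inserts, Finset.mem_insert, Finset.mem_singleton] at h
    rcases h with rfl | rfl
    · rw [induced, hself, hleaf]
    · rw [induced, hself, hleaf]
  | node l r hl hr =>
    have hself := induced_eq_self hs
    simp only [labels, List.mem_append, or_imp, forall_and] at hs
    simp only [inserts, Finset.mem_union, Finset.mem_insert, Finset.mem_singleton,
      Finset.mem_image] at h
    rcases h with (rfl | rfl) | (⟨l', hl', rfl⟩ | ⟨r', hr', rfl⟩)
    · rw [induced, hself, hleaf]
    · rw [induced, hself, hleaf]
    · rw [induced, hl hs.1 hl', induced_eq_self hs.2]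
    · rw [induced, hr hs.2 hr', induced_eq_self hs.1]

theorem eq_leaf_of_labels {x : α} {t : OrdTree α} (h : ∀ y ∈ t.labels, y = x)
    (hc : t.labels.count x = 1) : t = leaf x := by
  have hl : t.labels = [x] := by
    have := List.eq_replicate_of_mem h
    rw [this, List.count_replicate_self] at hc
    rw [this, hc]
    rfl
  cases t with
  | leaf a => simpa [labels] using hl
  | node l r =>
    have h1 := congrArg List.length hl
    have := l.numLeaves_pos
    have := r.numLeaves_pos
    simp only [labels, List.length_append, length_labels, List.length_singleton] at h1
    omega

/-- Exactly one child contains `x`. If nothing of that child survives deletion, it is `leaf x`,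
attached at its sibling; otherwise recurse into it. -/
theorem mem_inserts_of_induced {x : α} {s t : OrdTree α} {A : Finset α} (hx : x ∉ A)
    (ht : ∀ y ∈ t.labels, y ∈ A ∨ y = x) (hc : t.labels.count x = 1)
    (h : t.induced A = some s) : t ∈ inserts x s := by
  induction t generalizing s with
  | leaf a =>
    have : a = x := by
      by_contra hne
      simp [labels, hne] at hc
    simp [induced, this, hx] at h
  | node l r hl hr =>
    simp only [labels, List.mem_append, or_imp, forall_and, List.count_append] at ht hc
    have hself : ∀ u : OrdTree α, (∀ y ∈ u.labels, y ∈ A ∨ y = x) → u.labels.count x = 0 →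
        u.induced A = some u := fun u hu h0 => by
      rw [List.count_eq_zero] at h0
      refine induced_eq_self fun y hy => (hu y hy).resolve_right ?_
      rintro rfl
      exact h0 hy
    have hleaf : ∀ u : OrdTree α, (∀ y ∈ u.labels, y ∈ A ∨ y = x) → u.labels.count x = 1 →
        u.induced A = none → u = leaf x := fun u hu h1 hn =>
      eq_leaf_of_labels (fun y hy => (hu y hy).resolve_left (induced_eq_none_iff.1 hn y hy)) h1
    rcases Nat.eq_zero_or_pos (l.labels.count x) with h0 | h0
    · have hr1 : r.labels.count x = 1 := by omega
      rcases hr' : r.induced A with _ | r'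
      · simp only [induced, hself l ht.1 h0, hr', Option.some.injEq] at h
        rw [hleaf r ht.2 hr1 hr', h]
        exact node_leaf_mem_inserts x s
      · simp only [induced, hself l ht.1 h0, hr', Option.some.injEq] at h
        rw [← h]
        exact node_mem_inserts_right l (hr ht.2 hr1 hr')
    · have hl1 : l.labels.count x = 1 := by omega
      have h0 : r.labels.count x = 0 := by omega
      rcases hl' : l.induced A with _ | l'
      · simp only [induced, hself r ht.2 h0, hl', Option.some.injEq] at h
        rw [hleaf l ht.1 hl1 hl', h]
        exact leaf_node_mem_inserts x s
      · simp only [induced, hself r ht.2 h0, hl', Option.some.injEq] at h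
        rw [← h]
        exact node_mem_inserts_left r (hl ht.1 hl1 hl')

/-! ### Counting labelled trees and the fibres of restriction. -/

theorem finite_labelled [Finite α] (A : Finset α) :
    {t : OrdTree α | t.labels.Nodup ∧ t.labels.toFinset = A}.Finite := by
  refine (finite_numLeaves_eq A.card).subset fun t ht => ?_
  rw [Set.mem_ofPred_eq, ← length_labels, ← ht.2, List.toFinset_card_of_nodup ht.1]

/-- The ordered trees whose leaves are bijectively labelled by the elements of `A`. -/
noncomputable def treesOn [Finite α] (A : Finset α) : Finset (OrdTree α) :=
  (finite_labelled A).toFinset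

variable [Finite α]

theorem mem_treesOn {A : Finset α} {t : OrdTree α} :
    t ∈ treesOn A ↔ t.labels.Nodup ∧ t.labels.toFinset = A := by
  simp [treesOn]

theorem numLeaves_of_mem_treesOn {A : Finset α} {t : OrdTree α} (h : t ∈ treesOn A) :
    t.numLeaves = A.card := by
  rw [mem_treesOn] at h
  rw [← length_labels, ← h.2, List.toFinset_card_of_nodup h.1]

theorem mem_of_mem_treesOn {A : Finset α} {t : OrdTree α} (h : t ∈ treesOn A) {y : α} :
    y ∈ t.labels ↔ y ∈ A := by
  rw [← (mem_treesOn.1 h).2, List.mem_toFinset]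

theorem exists_induced_of_mem_treesOn {S A : Finset α} (hSA : S ⊆ A) (hS : S.Nonempty)
    {t : OrdTree α} (h : t ∈ treesOn A) : ∃ s ∈ treesOn S, t.induced S = some s := by
  rcases hs : t.induced S with _ | s
  · obtain ⟨y, hy⟩ := hS
    exact absurd hy (induced_eq_none_iff.1 hs y ((mem_of_mem_treesOn h).2 (hSA hy)))
  · refine ⟨s, ?_, rfl⟩
    rw [mem_treesOn, labels_of_induced_eq_some hs]
    refine ⟨(mem_treesOn.1 h).1.filter _, ?_⟩
    ext y
    simp only [List.mem_toFinset, List.mem_filter, decide_eq_true_eq, mem_of_mem_treesOn h]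
    exact ⟨fun h => h.2, fun h => ⟨hSA h, h⟩⟩

theorem mem_inserts_iff {x : α} {A : Finset α} (hx : x ∉ A) {s t : OrdTree α}
    (hs : s ∈ treesOn A) :
    t ∈ inserts x s ↔ t ∈ treesOn (insert x A) ∧ t.induced A = some s := by
  have hxs : x ∉ s.labels := by rwa [mem_of_mem_treesOn hs]
  constructor
  · intro h
    have hp := labels_perm_of_mem_inserts h
    refine ⟨mem_treesOn.2 ⟨?_, ?_⟩, induced_of_mem_inserts hx
      (fun y hy => (mem_of_mem_treesOn hs).1 hy) h⟩
    · rw [hp.nodup_iff, List.nodup_cons]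
      exact ⟨hxs, (mem_treesOn.1 hs).1⟩
    · rw [List.toFinset_eq_of_perm _ _ hp, List.toFinset_cons, (mem_treesOn.1 hs).2]
  · rintro ⟨h, hi⟩
    refine mem_inserts_of_induced hx (fun y hy => ?_) ?_ hi
    · rw [mem_of_mem_treesOn h, Finset.mem_insert] at hy
      exact hy.symm
    · exact List.count_eq_one_of_mem (mem_treesOn.1 h).1
        ((mem_of_mem_treesOn h).2 (Finset.mem_insert_self _ _))

-- Deleting `x` recovers the original tree, so attachments to distinct trees are distinct.
open Classical in
theorem card_biUnion_inserts {x : α} {A : Finset α} (hx : x ∉ A) {F : Finset (OrdTree α)}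
    (hF : F ⊆ treesOn A) : (F.biUnion (inserts x)).card = F.card * (4 * A.card - 2) := by
  rw [Finset.card_biUnion]
  · refine Finset.sum_const_nat fun s hs => ?_
    rw [card_inserts, numLeaves_of_mem_treesOn (hF hs)]
    rwa [mem_of_mem_treesOn (hF hs)]
  · intro s hs s' hs' hne
    refine Finset.disjoint_left.2 fun t ht ht' => hne ?_
    rw [mem_inserts_iff hx (hF hs)] at ht
    rw [mem_inserts_iff hx (hF hs')] at ht'
    exact Option.some_injective _ (ht.2.symm.trans ht'.2)

/-- The number of ordered trees with `a` labelled leaves. -/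
def treeCount (a : ℕ) : ℕ := 2 ^ (a - 1) * (2 * a - 3)‼

theorem treeCount_pos (a : ℕ) : 0 < treeCount a := by
  unfold treeCount
  have := Nat.doubleFactorial_pos (2 * a - 3)
  positivity

theorem treeCount_succ {a : ℕ} (ha : 1 ≤ a) : treeCount (a + 1) = treeCount a * (4 * a - 2) := by
  obtain ⟨b, rfl⟩ := Nat.exists_eq_add_of_le' ha
  rcases b with _ | b
  -- Here `2 * 1 - 3` truncates to `0`, and `0‼ = 1` stands in for `(-1)‼`.
  · simp [treeCount]
  · have h1 : 2 * (b + 1 + 1 + 1) - 3 = 2 * b + 1 + 2 := by omega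
    have h2 : 2 * (b + 1 + 1) - 3 = 2 * b + 1 := by omega
    have h3 : 4 * (b + 1 + 1) - 2 = 2 * (2 * b + 3) := by omega
    rw [treeCount, treeCount, h1, h2, h3, Nat.doubleFactorial_add_two]
    simp only [Nat.add_sub_cancel]
    ring

open Classical in
/-- All fibres of `induced S`, over the trees on `S`, have the same size. -/
theorem card_fiber_mul {S A : Finset α} (hSA : S ⊆ A) (hS : S.Nonempty) {s : OrdTree α}
    (hs : s ∈ treesOn S) :
    ((treesOn A).filter fun t => t.induced S = some s).card * treeCount S.card =
      treeCount A.card := by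
  induction hA : A.card - S.card generalizing A with
  | zero =>
    obtain rfl : S = A := Finset.eq_of_subset_of_card_le hSA (by omega)
    have : ((treesOn S).filter fun t => t.induced S = some s) = {s} := by
      ext t
      simp only [Finset.mem_filter, Finset.mem_singleton]
      constructor
      · rintro ⟨ht, h⟩
        rw [induced_eq_self fun y hy => (mem_of_mem_treesOn ht).1 hy] at h
        exact Option.some_injective _ h
      · rintro rfl
        exact ⟨hs, induced_eq_self fun y hy => (mem_of_mem_treesOn hs).1 hy⟩
    rw [this, Finset.card_singleton, one_mul]
  | succ m ih =>
    obtain ⟨x, hxA, hxS⟩ : ∃ x ∈ A, x ∉ S := by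
      by_contra! h
      have := Finset.card_le_card (show A ⊆ S from h)
      omega
    have hSB : S ⊆ A.erase x := fun y hy => Finset.mem_erase.2 ⟨by rintro rfl; exact hxS hy, hSA hy⟩
    have hcard := Finset.card_erase_add_one hxA
    have hBpos := (hS.mono hSB).card_pos
    have hx := Finset.notMem_erase x A
    generalize hB : A.erase x = B at *
    have hins : insert x B = A := by rw [← hB, Finset.insert_erase hxA]
    -- Deleting `x` maps the fibre over `A` onto the fibre over `B`, each tree of which has `4 *
    -- B.card - 2` preimages; `treeCount` grows by the same factor.
    have key : ((treesOn A).filter fun t => t.induced S = some s) =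
        ((treesOn B).filter fun t => t.induced S = some s).biUnion (inserts x) := by
      ext t
      simp only [Finset.mem_filter, Finset.mem_biUnion]
      constructor
      · rintro ⟨ht, h⟩
        obtain ⟨u, hu, htu⟩ := exists_induced_of_mem_treesOn
          (hins ▸ Finset.subset_insert x B) (hS.mono hSB) ht
        refine ⟨u, ⟨hu, ?_⟩, (mem_inserts_iff hx hu).2 ⟨hins ▸ ht, htu⟩⟩
        rw [← h, ← induced_bind hSB t, htu, Option.bind_some]
      · rintro ⟨u, ⟨hu, h⟩, ht⟩
        obtain ⟨h1, h2⟩ := (mem_inserts_iff hx hu).1 ht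
        exact ⟨hins ▸ h1, by rw [← induced_bind hSB t, h2, Option.bind_some, h]⟩
    rw [key, card_biUnion_inserts hx (Finset.filter_subset _ _), ← hcard, treeCount_succ hBpos,
      ← ih hSB (by omega)]
    ring

/-- The case of a singleton `S = {x}`: it carries only one tree, so its fibre is everything. -/
theorem card_treesOn {A : Finset α} (hA : A.Nonempty) : (treesOn A).card = treeCount A.card := by
  classical
  obtain ⟨x, hx⟩ := hA
  have hs : leaf x ∈ treesOn {x} := by simp [mem_treesOn, labels]
  have h := card_fiber_mul (Finset.singleton_subset_iff.2 hx) (Finset.singleton_nonempty x) hs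
  have h1 : treeCount ({x} : Finset α).card = 1 := by simp [treeCount]
  rw [h1, mul_one] at h
  rw [← h, Finset.filter_true_of_mem]
  intro t ht
  obtain ⟨s, hs, hts⟩ := exists_induced_of_mem_treesOn (Finset.singleton_subset_iff.2 hx)
    (Finset.singleton_nonempty x) ht
  rw [hts, eq_leaf_of_labels (fun y hy => by simpa using (mem_of_mem_treesOn hs).1 hy)
    (List.count_eq_one_of_mem (mem_treesOn.1 hs).1 ((mem_of_mem_treesOn hs).2 (by simp)))]

end OrdTree

/-! ### Vertices, and labelled trees as shapes with a list of labels. -/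

namespace OrdTree

/-- The vertices of a tree, as words over `{0, 1}`. -/
def vertices : OrdTree Unit → Finset (List ℕ)
  | leaf _ => {[]}
  | node l r => insert [] (l.vertices.image (List.cons 0) ∪ r.vertices.image (List.cons 1))

/-- The number of children of a vertex of a tree. -/
def outDegree : OrdTree Unit → List ℕ → ℕ
  | leaf _, _ => 0
  | node _ _, [] => 2
  | node l _, 0 :: w => l.outDegree w
  | node _ r, (_ + 1) :: w => r.outDegree w

theorem outDegree_eq (t : OrdTree Unit) (w : List ℕ) : t.outDegree w = 0 ∨ t.outDegree w = 2 := by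
  induction t generalizing w with
  | leaf a => exact Or.inl rfl
  | node l r hl hr =>
    match w with
    | [] => exact Or.inr rfl
    | 0 :: w => exact hl w
    | (_ + 1) :: w => exact hr w

theorem card_vertices (t : OrdTree Unit) : t.vertices.card = 2 * t.numLeaves - 1 := by
  induction t with
  | leaf a => rfl
  | node l r hl hr =>
    have := l.numLeaves_pos
    have := r.numLeaves_pos
    rw [vertices, Finset.card_insert_of_notMem (by simp), Finset.card_union_of_disjoint,
      Finset.card_image_of_injective _ (List.cons_injective),
      Finset.card_image_of_injective _ (List.cons_injective), hl, hr, numLeaves]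
    · omega
    · rw [Finset.disjoint_left]
      simp

theorem exists_numLeaves_eq {n : ℕ} (hn : 1 ≤ n) : ∃ t : OrdTree Unit, t.numLeaves = n := by
  induction n, hn using Nat.le_induction with
  | base => exact ⟨leaf (), rfl⟩
  | succ n _ ih =>
    obtain ⟨t, ht⟩ := ih
    exact ⟨node t (leaf ()), by simp [numLeaves, ht]⟩

variable {α : Type}

theorem eq_of_shape_of_labels {s t : OrdTree α} (hs : s.shape = t.shape)
    (hl : s.labels = t.labels) : s = t := by
  induction s generalizing t with
  | leaf a =>
    cases t with
    | leaf b => simpa [labels] using hl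
    | node l r => simp [shape] at hs
  | node l r ihl ihr =>
    cases t with
    | leaf b => simp [shape] at hs
    | node l' r' =>
      simp only [shape, node.injEq] at hs
      have hlen : l.labels.length = l'.labels.length := by
        rw [length_labels, length_labels, ← numLeaves_shape, hs.1, numLeaves_shape]
      obtain ⟨h1, h2⟩ := List.append_inj hl hlen
      rw [ihl hs.1 h1, ihr hs.2 h2]

/-- With `eq_of_shape_of_labels`, labelled trees of a fixed shape correspond bijectively to label
lists of the right length. -/
theorem exists_shape_labels (t : OrdTree Unit) (L : List α) (h : L.length = t.numLeaves) :
    ∃ s : OrdTree α, s.shape = t ∧ s.labels = L := by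
  induction t generalizing L with
  | leaf a =>
    obtain ⟨x, rfl⟩ := List.length_eq_one_iff.1 h
    exact ⟨leaf x, rfl, rfl⟩
  | node l r ihl ihr =>
    simp only [numLeaves] at h
    obtain ⟨s, hs, hs'⟩ := ihl (L.take l.numLeaves) (by simp; omega)
    obtain ⟨u, hu, hu'⟩ := ihr (L.drop l.numLeaves) (by simp; omega)
    exact ⟨node s u, by simp [shape, hs, hu], by simp [labels, hs', hu']⟩

end OrdTree

/-! ### Uniformity of the conditioned Galton–Watson tree. -/

namespace GaltonWatson

open OrdTree

/-- This exhibits the event as a finite cylinder, whose product measure is one factor per vertex. -/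
theorem isTerminalTree_iff (ξ : List ℕ → ℕ) (v : List ℕ) (t : OrdTree Unit) :
    IsTerminalTree ξ v t ↔ ∀ w ∈ t.vertices, ξ (v ++ w) = t.outDegree w := by
  induction t generalizing v with
  | leaf a => simp [IsTerminalTree, vertices, outDegree]
  | node l r hl hr =>
    simp [IsTerminalTree, vertices, hl, hr, or_imp, forall_and, outDegree]

theorem offspring_singleton {k : ℕ} (hk : k = 0 ∨ k = 2) : offspring.toMeasure {k} = 2⁻¹ := by
  rw [PMF.toMeasure_apply_singleton _ _ (measurableSet_singleton k)]
  refine (PMF.uniformOfFinset_apply_of_mem _ (by simpa using hk)).trans ?_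
  norm_num

/-- The probability that the terminal tree is a given tree only depends on its size. -/
theorem process_isTerminalTree (t : OrdTree Unit) :
    process {ξ | IsTerminalTree ξ [] t} = 2⁻¹ ^ (2 * t.numLeaves - 1) := by
  have h : {ξ | IsTerminalTree ξ [] t} =
      Set.pi (t.vertices : Set (List ℕ)) fun w => {t.outDegree w} := by
    ext ξ
    simp [isTerminalTree_iff, Set.mem_pi]
  rw [h, process, Measure.infinitePi_pi _ fun _ _ => measurableSet_singleton _,
    Finset.prod_congr rfl fun w _ => offspring_singleton (t.outDegree_eq w), Finset.prod_const,
    card_vertices]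

theorem terminalLaw_singleton (t : OrdTree Unit) :
    terminalLaw {t} = 2⁻¹ ^ (2 * t.numLeaves - 1) := by
  classical
  rw [terminalLaw, Measure.sum_apply _ (measurableSet_singleton t), tsum_eq_single t]
  · simp [process_isTerminalTree]
  · intro s hs
    simp [hs]

theorem terminalLaw_numLeaves_ne_zero {n : ℕ} (hn : 1 ≤ n) :
    terminalLaw {t | t.numLeaves = n} ≠ 0 := by
  obtain ⟨t, ht⟩ := exists_numLeaves_eq hn
  intro h
  have hsub : {t} ⊆ {t : OrdTree Unit | t.numLeaves = n} := Set.singleton_subset_iff.2 ht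
  have h0 := measure_mono_null hsub h
  rw [terminalLaw_singleton] at h0
  simp at h0

theorem terminalLaw_numLeaves_ne_top (n : ℕ) : terminalLaw {t | t.numLeaves = n} ≠ ⊤ := by
  have hfin := finite_numLeaves_eq (α := Unit) n
  rw [← hfin.coe_toFinset, ← sum_measure_singleton]
  exact ENNReal.sum_ne_top.2 fun t _ => by simp [terminalLaw_singleton]

theorem cond_terminalLaw_singleton (n : ℕ) {t : OrdTree Unit} (ht : t.numLeaves = n) :
    cond terminalLaw {t | t.numLeaves = n} {t} =
      (terminalLaw {t | t.numLeaves = n})⁻¹ * 2⁻¹ ^ (2 * n - 1) := by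
  have h : {t | t.numLeaves = n} ∩ {t} = {t} :=
    Set.inter_eq_self_of_subset_right (Set.singleton_subset_iff.2 ht)
  rw [cond_apply (DiscreteMeasurableSpace.forall_measurableSet _), h, terminalLaw_singleton, ht]

theorem mem_labellings_shape_iff {n : ℕ} {T : OrdTree (Fin n)} :
    T ∈ labellings n T.shape ↔ T ∈ treesOn Finset.univ := by
  simp [labellings, mem_treesOn, Finset.eq_univ_iff_forall]

theorem labellings_subset (n : ℕ) (t : OrdTree Unit) :
    labellings n t ⊆ (treesOn Finset.univ : Finset (OrdTree (Fin n))) := by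
  rintro T hT
  have := hT.1
  subst this
  exact mem_labellings_shape_iff.1 hT

theorem finite_labellings (n : ℕ) (t : OrdTree Unit) : (labellings n t).Finite :=
  (Finset.finite_toSet _).subset (labellings_subset n t)

theorem image_labels_labellings {n : ℕ} {t : OrdTree Unit} (ht : t.numLeaves = n) :
    labels '' labellings n t = {L | L.Nodup ∧ ∀ i, i ∈ L} := by
  ext L
  constructor
  · rintro ⟨T, hT, rfl⟩
    exact hT.2
  · rintro ⟨h1, h2⟩
    have hlen : L.length = t.numLeaves := by
      have huniv : L.toFinset = Finset.univ := Finset.eq_univ_iff_forall.2 fun i => by simp [h2 i]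
      rw [ht, ← List.toFinset_card_of_nodup h1, huniv, Finset.card_univ, Fintype.card_fin]
    obtain ⟨T, hT, rfl⟩ := exists_shape_labels t L hlen
    exact ⟨T, ⟨hT, h1, h2⟩, rfl⟩

/-- The count is that of orderings of `Fin n`, whatever the shape. -/
theorem encard_labellings {n : ℕ} {t : OrdTree Unit} (ht : t.numLeaves = n) :
    (labellings n t).encard = {L : List (Fin n) | L.Nodup ∧ ∀ i, i ∈ L}.encard := by
  rw [← image_labels_labellings ht, Set.InjOn.encard_image]
  intro T hT T' hT' h
  exact eq_of_shape_of_labels (hT.1.trans hT'.1.symm) h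

theorem labellings_nonempty {n : ℕ} {t : OrdTree Unit} (ht : t.numLeaves = n) :
    (labellings n t).Nonempty := by
  rw [← Set.image_nonempty, image_labels_labellings ht]
  exact ⟨List.finRange n, List.nodup_finRange n, List.mem_finRange⟩

theorem isProbabilityMeasure_treeLaw {n : ℕ} (hn : 1 ≤ n) : IsProbabilityMeasure (treeLaw n) := by
  have hs : MeasurableSet {t : OrdTree Unit | t.numLeaves = n} :=
    DiscreteMeasurableSpace.forall_measurableSet _
  have := cond_isProbabilityMeasure_of_finite (terminalLaw_numLeaves_ne_zero hn)
    (terminalLaw_numLeaves_ne_top n)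
  refine ⟨?_⟩
  rw [treeLaw, Measure.bind_apply MeasurableSet.univ measurable_from_top.aemeasurable,
    lintegral_congr_ae (g := fun _ => 1), lintegral_one, measure_univ]
  filter_upwards [ae_cond_mem hs] with t ht
  exact uniformOn_of_univ (finite_labellings n t) (labellings_nonempty ht)

theorem treeLaw_singleton {n : ℕ} (T : OrdTree (Fin n)) :
    treeLaw n {T} = uniformOn (labellings n T.shape) {T} *
      cond terminalLaw {t | t.numLeaves = n} {T.shape} := by
  rw [treeLaw, Measure.bind_apply (measurableSet_singleton T) measurable_from_top.aemeasurable,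
    ← lintegral_indicator_const (measurableSet_singleton T.shape)]
  refine lintegral_congr fun t => ?_
  by_cases ht : t = T.shape
  · subst ht
    simp
  · rw [Set.indicator_of_notMem (by simpa using ht),
      uniformOn_eq_zero_iff (finite_labellings n t), Set.inter_singleton_eq_empty]
    exact fun hT => ht hT.1.symm

/-- `T_n` is uniformly distributed on the ordered trees with the leaf-set `[n]`. -/
theorem treeLaw_eq {n : ℕ} (hn : 1 ≤ n) :
    treeLaw n = uniformOn ((treesOn Finset.univ : Finset (OrdTree (Fin n))) : Set _) := by
  have := isProbabilityMeasure_treeLaw hn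
  set F : Finset (OrdTree (Fin n)) := treesOn Finset.univ with hF
  have h0 : ∀ T ∉ F, treeLaw n {T} = 0 := by
    intro T hT
    rw [treeLaw_singleton, (uniformOn_eq_zero_iff (finite_labellings n _)).2, zero_mul]
    rw [Set.inter_singleton_eq_empty]
    exact fun h => hT (labellings_subset n _ h)
  -- The common mass is the reciprocal number of labellings times the conditional mass of a shape;
  -- total mass one then forces `c = 1 / F.card`, so neither factor needs evaluating.
  obtain ⟨c, hc⟩ : ∃ c, ∀ T ∈ F, treeLaw n {T} = c := by
    refine ⟨({L : List (Fin n) | L.Nodup ∧ ∀ i, i ∈ L}.encard : ENNReal)⁻¹ *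
      ((terminalLaw {t | t.numLeaves = n})⁻¹ * 2⁻¹ ^ (2 * n - 1)), fun T hT => ?_⟩
    have hnum : T.shape.numLeaves = n := by
      rw [numLeaves_shape, numLeaves_of_mem_treesOn hT, Finset.card_univ, Fintype.card_fin]
    have hmem := mem_labellings_shape_iff.2 hT
    rw [treeLaw_singleton, cond_terminalLaw_singleton n hnum, ← encard_labellings hnum, uniformOn,
      cond_apply (DiscreteMeasurableSpace.forall_measurableSet _),
      Set.inter_eq_self_of_subset_right (Set.singleton_subset_iff.2 hmem),
      Measure.count_singleton, mul_one, Measure.count_apply]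
    exact DiscreteMeasurableSpace.forall_measurableSet _
  have hcompl : treeLaw n (F : Set (OrdTree (Fin n)))ᶜ = 0 := by
    rw [← Set.biUnion_of_singleton (F : Set (OrdTree (Fin n)))ᶜ,
      measure_biUnion_null_iff (Set.to_countable _)]
    exact fun T hT => h0 T (by simpa using hT)
  have hone : (F.card : ENNReal) * c = 1 := by
    rw [← nsmul_eq_mul, ← Finset.sum_const, ← Finset.sum_congr rfl hc, sum_measure_singleton,
      ← prob_compl_eq_zero_iff F.measurableSet]
    exact hcompl
  classical
  refine Measure.ext_of_singleton fun T => ?_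
  rw [← Finset.coe_singleton, uniformOn_apply_finset, Finset.coe_singleton]
  by_cases hT : T ∈ F
  · rw [hc T hT, Finset.inter_singleton_of_mem hT, Finset.card_singleton, Nat.cast_one, one_div]
    exact ENNReal.eq_inv_of_mul_eq_one_left (by rw [mul_comm]; exact hone)
  · simp [h0 T hT, Finset.inter_singleton_of_notMem hT]

/-! ### First moment of the number of agreement sets. -/

variable {n : ℕ}

theorem treesOn_nonempty {A : Finset (Fin n)} (hA : A.Nonempty) : (treesOn A).Nonempty := by
  rw [← Finset.card_pos, card_treesOn hA]
  exact treeCount_pos _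

theorem univ_nonempty_of_one_le (hn : 1 ≤ n) : (Finset.univ : Finset (Fin n)).Nonempty :=
  ⟨⟨0, hn⟩, Finset.mem_univ _⟩

/-- The tree induced by `S` in `T_n` is uniformly distributed on the trees with leaf-set `S`. -/
theorem treeLaw_induced (hn : 1 ≤ n) {S : Finset (Fin n)} (hS : S.Nonempty)
    {s : OrdTree (Fin n)} (hs : s ∈ treesOn S) :
    treeLaw n {T | T.induced S = some s} = (treeCount S.card : ENNReal)⁻¹ := by
  classical
  set F : Finset (OrdTree (Fin n)) := treesOn Finset.univ with hF
  have hfib := card_fiber_mul (Finset.subset_univ S) hS hs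
  rw [← card_treesOn (univ_nonempty_of_one_le hn)] at hfib
  have hcoe : (F : Set (OrdTree (Fin n))) ∩ {T | T.induced S = some s} =
      (F.filter fun T => T.induced S = some s : Finset (OrdTree (Fin n))) := by
    ext; simp
  rw [treeLaw_eq hn, ← uniformOn_inter_self F.finite_toSet, hcoe, uniformOn_apply_finset,
    Finset.inter_eq_right.2 (Finset.filter_subset _ _), hF, ← hfib, Nat.cast_mul,
    ENNReal.div_eq_inv_mul, ENNReal.mul_inv (Or.inr (by simp)) (Or.inl (by simp)), mul_right_comm,
    ENNReal.inv_mul_cancel, one_mul]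
  · rw [Nat.cast_ne_zero]
    rintro h0
    rw [h0, zero_mul] at hfib
    exact (treesOn_nonempty (univ_nonempty_of_one_le hn)).card_pos.ne hfib
  · simp

/-- Fix the first tree: whatever it induces on `S`, the second induces the same with one and the
same probability. -/
theorem pairLaw_induced_eq (hn : 1 ≤ n) {S : Finset (Fin n)} (hS : S.Nonempty) :
    pairLaw n {T | T.1.induced S = T.2.induced S} = (treeCount S.card : ENNReal)⁻¹ := by
  have := isProbabilityMeasure_treeLaw hn
  rw [pairLaw, Measure.prod_apply (DiscreteMeasurableSpace.forall_measurableSet _),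
    lintegral_congr_ae (g := fun _ => (treeCount S.card : ENNReal)⁻¹), lintegral_const,
    measure_univ, mul_one]
  have hmem : ∀ᵐ T ∂treeLaw n, T ∈ (treesOn Finset.univ : Finset (OrdTree (Fin n))) := by
    rw [treeLaw_eq hn]
    exact ae_cond_mem (DiscreteMeasurableSpace.forall_measurableSet _)
  filter_upwards [hmem] with T hT
  obtain ⟨s, hs, hTs⟩ := exists_induced_of_mem_treesOn (Finset.subset_univ S) hS hT
  rw [← treeLaw_induced hn hS hs]
  congr 1
  ext T'
  simp [hTs, eq_comm]

theorem isProbabilityMeasure_pairLaw (hn : 1 ≤ n) : IsProbabilityMeasure (pairLaw n) := by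
  have := isProbabilityMeasure_treeLaw hn
  unfold pairLaw
  infer_instance

theorem numAgreement_eq_sum (a : ℕ) (T : OrdTree (Fin n) × OrdTree (Fin n)) :
    (numAgreement a T : ℝ) = ∑ S ∈ Finset.univ.powersetCard a,
      Set.indicator {T : OrdTree (Fin n) × OrdTree (Fin n) | T.1.induced S = T.2.induced S} 1 T := by
  classical
  have h : (agreementSets T).filter (fun S => S.card = a) =
      (Finset.univ.powersetCard a).filter fun S => T.1.induced S = T.2.induced S := by
    ext S
    simp [agreementSets, Finset.mem_powersetCard, and_comm]
  rw [numAgreement, h, Finset.card_filter, Nat.cast_sum]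
  refine Finset.sum_congr rfl fun S _ => ?_
  simp [Set.indicator_apply]

theorem integrable_indicator_induced_eq (hn : 1 ≤ n) (S : Finset (Fin n)) :
    Integrable (Set.indicator {T : OrdTree (Fin n) × OrdTree (Fin n) |
      T.1.induced S = T.2.induced S} (1 : OrdTree (Fin n) × OrdTree (Fin n) → ℝ)) (pairLaw n) := by
  have := isProbabilityMeasure_pairLaw hn
  exact (integrable_const (1 : ℝ)).indicator (DiscreteMeasurableSpace.forall_measurableSet _)

theorem integrable_numAgreement (hn : 1 ≤ n) (a : ℕ) :
    Integrable (fun T => (numAgreement a T : ℝ)) (pairLaw n) := by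
  simp only [numAgreement_eq_sum]
  exact integrable_finsetSum _ fun S _ => integrable_indicator_induced_eq hn S

theorem integral_numAgreement (hn : 1 ≤ n) {a : ℕ} (ha : 1 ≤ a) :
    ∫ T, (numAgreement a T : ℝ) ∂(pairLaw n) = (n.choose a : ℝ) / treeCount a := by
  simp only [numAgreement_eq_sum]
  rw [integral_finsetSum _ fun S _ => integrable_indicator_induced_eq hn S,
    Finset.sum_congr rfl (g := fun _ => (treeCount a : ℝ)⁻¹)]
  · simp [Finset.card_powersetCard, div_eq_mul_inv]
  · intro S hS
    have hcard := (Finset.mem_powersetCard.1 hS).2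
    rw [integral_indicator_one (DiscreteMeasurableSpace.forall_measurableSet _), Measure.real,
      pairLaw_induced_eq hn (Finset.card_pos.1 (by omega)), hcard, ENNReal.toReal_inv,
      ENNReal.toReal_natCast]

/-- Union bound over the sets of more than `c` leaves, grouped by cardinality. The condition `0 ≤ c`
leaves out the empty set, on which all trees agree. -/
theorem real_lt_mast_le (hn : 1 ≤ n) {c : ℝ} (hc : 0 ≤ c) :
    (pairLaw n).real {T | c < mast T} ≤
      ∑ a ∈ Finset.range (n + 1), if c < a then (n.choose a : ℝ) / treeCount a else 0 := by
  classical
  have := isProbabilityMeasure_pairLaw hn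
  have hsub : {T : OrdTree (Fin n) × OrdTree (Fin n) | c < mast T} ⊆
      ⋃ S ∈ (Finset.univ : Finset (Finset (Fin n))).filter fun S => c < S.card,
        {T | T.1.induced S = T.2.induced S} := by
    intro T hT
    have hne : (agreementSets T).Nonempty := by
      by_contra h
      rw [Finset.not_nonempty_iff_eq_empty] at h
      have hT : c < (mast T : ℝ) := hT
      simp [mast, h] at hT
      linarith
    obtain ⟨S, hS, hmax⟩ := Finset.exists_mem_eq_sup _ hne Finset.card
    have hT : c < (mast T : ℝ) := hT
    rw [mast, hmax] at hT
    simp only [agreementSets, Finset.mem_filter, Finset.mem_univ, true_and] at hS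
    simp only [Set.mem_iUnion, Finset.mem_filter, Finset.mem_univ, true_and]
    exact ⟨S, hT, hS⟩
  refine ((measureReal_mono hsub (measure_ne_top _ _)).trans (measureReal_biUnion_finset_le _ _)).trans ?_
  have hterm : ∀ S ∈ (Finset.univ : Finset (Finset (Fin n))).filter fun S => c < S.card,
      (pairLaw n).real {T | T.1.induced S = T.2.induced S} = (treeCount S.card : ℝ)⁻¹ := by
    intro S hS
    have hS : c < S.card := (Finset.mem_filter.1 hS).2
    have hpos : 0 < S.card := by exact_mod_cast hc.trans_lt hS
    rw [Measure.real, pairLaw_induced_eq hn (Finset.card_pos.1 hpos), ENNReal.toReal_inv,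
      ENNReal.toReal_natCast]
  rw [Finset.sum_congr rfl hterm, Finset.sum_filter, ← Finset.powerset_univ,
    Finset.sum_powerset_apply_card fun a : ℕ => if c < a then (treeCount a : ℝ)⁻¹ else 0,
    Finset.card_univ, Fintype.card_fin]
  refine Finset.sum_le_sum fun a _ => le_of_eq ?_
  split_ifs <;> simp [div_eq_mul_inv]

end GaltonWatson

/-! ### Estimates for the expected number of agreement sets. -/

namespace OrdTree

theorem treeCount_mul_factorial (b : ℕ) : treeCount (b + 1) * b ! = (2 * b)! := by
  induction b with
  | zero => simp [treeCount]
  | succ b ih =>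
    have h : 4 * (b + 1) - 2 = 2 * (2 * b + 1) := by omega
    rw [treeCount_succ (by omega), Nat.factorial_succ, h,
      show 2 * (b + 1) = 2 * b + 1 + 1 by ring, Nat.factorial_succ, Nat.factorial_succ, ← ih]
    ring

theorem choose_div_treeCount_le {n a : ℕ} (ha : 1 ≤ a) (han : a ≤ n) :
    (n.choose a : ℝ) / treeCount a ≤ 4 * n * ((n : ℝ) ^ a / (2 * a)!) := by
  obtain ⟨b, rfl⟩ := Nat.exists_eq_add_of_le' ha
  have hpos : (0 : ℝ) < treeCount (b + 1) := by exact_mod_cast treeCount_pos _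
  have hb : (0 : ℝ) < b ! := by exact_mod_cast Nat.factorial_pos b
  have hc : (n.choose (b + 1) : ℝ) ≤ (n : ℝ) ^ (b + 1) / (b + 1)! := Nat.choose_le_pow_div _ _
  have hbn : ((b + 1 : ℕ) : ℝ) ≤ n := by exact_mod_cast han
  have hfac : ((2 * (b + 1))! : ℝ) = (2 * b + 2) * (2 * b + 1) * (treeCount (b + 1) * b !) := by
    have h : (2 * (b + 1))! = (2 * b + 2) * (2 * b + 1) * (treeCount (b + 1) * b !) := by
      rw [treeCount_mul_factorial, show 2 * (b + 1) = 2 * b + 1 + 1 by ring, Nat.factorial_succ,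
        Nat.factorial_succ]
      ring
    rw [h]
    push_cast
    ring
  calc (n.choose (b + 1) : ℝ) / treeCount (b + 1)
      ≤ (n : ℝ) ^ (b + 1) / (b + 1)! / treeCount (b + 1) := by gcongr
    -- With `a = b + 1`, the denominator is `a! * (2a-2)! / (a-1)! = (2a)! / (2(2a-1))`.
    _ = 2 * (2 * b + 1) * ((n : ℝ) ^ (b + 1) / (2 * (b + 1))!) := by
      rw [hfac, Nat.factorial_succ]
      push_cast
      field_simp
    _ ≤ 4 * n * ((n : ℝ) ^ (b + 1) / (2 * (b + 1))!) := by
      push_cast at hbn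
      refine mul_le_mul_of_nonneg_right ?_ (by positivity)
      linarith

/-- The weak Stirling bound `m ^ m / m! ≤ e ^ m`, with slack `u`. -/
theorem pow_div_factorial_le {x u : ℝ} (hx : 0 < x) (hu : 0 < u) {m : ℕ}
    (h : u * Real.exp 1 * x ≤ m) : x ^ m / m ! ≤ (u ^ m)⁻¹ := by
  have h1 := Real.pow_div_factorial_le_exp (m : ℝ) (Nat.cast_nonneg m) m
  have hm : (0 : ℝ) < m ! := by exact_mod_cast Nat.factorial_pos m
  rw [div_le_iff₀ hm] at h1
  have h2 : (u * Real.exp 1 * x) ^ m ≤ Real.exp m * m ! :=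
    (pow_le_pow_left₀ (by positivity) h m).trans h1
  rw [mul_pow, mul_pow, ← Real.exp_nat_mul, mul_one] at h2
  rw [div_le_iff₀ hm, ← div_eq_inv_mul, le_div_iff₀ (by positivity)]
  refine le_of_mul_le_mul_left ?_ (Real.exp_pos m)
  linarith

theorem exp_half_le {d : ℝ} (h0 : 0 ≤ d) (h1 : d ≤ 1) : Real.exp (d / 2) ≤ 1 + d := by
  refine (Real.exp_bound_div_one_sub_of_interval (by linarith) (by linarith)).trans ?_
  rw [div_le_iff₀ (by linarith)]
  nlinarith

theorem choose_div_treeCount_le_exp {n a : ℕ} (hn : 1 ≤ n) (han : a ≤ n)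
    (h : (1 + (√√n)⁻¹) * (Real.exp 1 / 2) * √n < a) :
    (n.choose a : ℝ) / treeCount a ≤ 4 * n * Real.exp (-√√n) := by
  have hn1 : (1 : ℝ) ≤ n := by exact_mod_cast hn
  set x := √(n : ℝ) with hx
  have hx1 : 1 ≤ x := Real.one_le_sqrt.2 hn1
  set y := √x with hy
  have hy1 : 1 ≤ y := Real.one_le_sqrt.2 hx1
  have hxx : x ^ 2 = n := Real.sq_sqrt (by linarith)
  have hyy : y ^ 2 = x := Real.sq_sqrt (by linarith)
  have hd0 : 0 < y⁻¹ := by positivity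
  have hd1 : y⁻¹ ≤ 1 := inv_le_one_of_one_le₀ hy1
  have hpos : (0 : ℝ) < a := lt_of_le_of_lt (by positivity) h
  -- Only `e / 2 ≥ 1` is needed here.
  have hxa : x ≤ a := by
    have he : 2 ≤ Real.exp 1 := by linarith [Real.add_one_le_exp (1 : ℝ)]
    refine le_trans ?_ h.le
    have : 1 ≤ (1 + y⁻¹) * (Real.exp 1 / 2) := by nlinarith
    nlinarith
  refine (choose_div_treeCount_le (by exact_mod_cast hpos) han).trans ?_
  gcongr
  rw [← hxx, ← pow_mul]
  -- Source of the constant `e / 2`: the Stirling bound is applied to `n ^ a / (2a)! = x ^ (2a) /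
  -- (2a)!`, so the threshold `e * x` is for `2a`.
  have hm : (1 + y⁻¹) * Real.exp 1 * x ≤ (2 * a : ℕ) := by
    push_cast
    linarith
  refine (pow_div_factorial_le (by linarith) (by linarith) hm).trans ?_
  rw [Real.exp_neg]
  gcongr
  -- The exponent is `a / y ≥ x / y = y`.
  calc Real.exp y ≤ Real.exp (((2 * a : ℕ) : ℝ) * (y⁻¹ / 2)) := by
        rw [Real.exp_le_exp]
        push_cast
        have : y⁻¹ * x ≤ y⁻¹ * a := by gcongr
        have h2 : y⁻¹ * x = y := by rw [← hyy]; field_simp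
        linarith
    _ = Real.exp (y⁻¹ / 2) ^ (2 * a) := Real.exp_nat_mul _ _
    _ ≤ (1 + y⁻¹) ^ (2 * a) := by
        gcongr
        exact exp_half_le hd0.le hd1

end OrdTree

/-! ### The upper tail of the maximum agreement subtree. -/

namespace GaltonWatson

open OrdTree

theorem tendsto_sqrt_sqrt_natCast : Tendsto (fun n : ℕ => √√(n : ℝ)) atTop atTop :=
  Real.tendsto_sqrt_atTop.comp (Real.tendsto_sqrt_atTop.comp tendsto_natCast_atTop_atTop)

theorem real_lt_mast_le_exp {n : ℕ} (hn : 1 ≤ n) :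
    (pairLaw n).real {T | (1 + (√√n)⁻¹) * (Real.exp 1 / 2) * √n < mast T} ≤
      8 * (√√n ^ 8 * Real.exp (-√√n)) := by
  have hn1 : (1 : ℝ) ≤ n := by exact_mod_cast hn
  have h8 : √√(n : ℝ) ^ 8 = n ^ 2 := by
    rw [show 8 = 2 * 4 by rfl, pow_mul, Real.sq_sqrt (by positivity), show 4 = 2 * 2 by rfl,
      pow_mul, Real.sq_sqrt (by positivity)]
  refine (real_lt_mast_le hn (by positivity)).trans ?_
  calc _ ≤ ∑ a ∈ Finset.range (n + 1), 4 * n * Real.exp (-√√n) := by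
        refine Finset.sum_le_sum fun a ha => ?_
        split_ifs with h
        · exact choose_div_treeCount_le_exp hn (Nat.lt_succ_iff.1 (Finset.mem_range.1 ha)) h
        · positivity
    _ = (n + 1) * (4 * n) * Real.exp (-√√n) := by
        rw [Finset.sum_const, Finset.card_range, nsmul_eq_mul]
        push_cast
        ring
    -- In terms of `y = √√n` this is `8 * y ^ 8 * exp (-y)`, which tends to zero.
    _ ≤ 8 * n ^ 2 * Real.exp (-√√n) := by
        refine mul_le_mul_of_nonneg_right ?_ (Real.exp_pos _).le
        nlinarith
    _ = _ := by rw [h8]; ring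

theorem tendsto_real_mast_le :
    Tendsto (fun n : ℕ => (pairLaw n).real
      {T | (mast T : ℝ) ≤ (1 + (√√n)⁻¹) * (Real.exp 1 / 2) * √n}) atTop (𝓝 1) := by
  have hlim : Tendsto (fun n : ℕ => 1 - 8 * (√√(n : ℝ) ^ 8 * Real.exp (-√√n))) atTop (𝓝 1) := by
    have h := (Real.tendsto_pow_mul_exp_neg_atTop_nhds_zero 8).comp tendsto_sqrt_sqrt_natCast
    simpa using (h.const_mul 8).const_sub 1
  refine tendsto_of_tendsto_of_tendsto_of_le_of_le' hlim tendsto_const_nhds ?_ ?_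
  · filter_upwards [eventually_ge_atTop 1] with n hn
    have := isProbabilityMeasure_pairLaw hn
    have hcompl : {T : OrdTree (Fin n) × OrdTree (Fin n) |
        (mast T : ℝ) ≤ (1 + (√√n)⁻¹) * (Real.exp 1 / 2) * √n} =
        {T | (1 + (√√n)⁻¹) * (Real.exp 1 / 2) * √n < mast T}ᶜ := by
      ext; simp
    rw [hcompl, probReal_compl_eq_one_sub (DiscreteMeasurableSpace.forall_measurableSet _)]
    linarith [real_lt_mast_le_exp hn]
  · filter_upwards [eventually_ge_atTop 1] with n hn
    have := isProbabilityMeasure_pairLaw hn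
    exact measureReal_le_one

end GaltonWatson

theorem theorem3 :
    (∀ n a : ℕ, 1 ≤ n → 1 ≤ a →
      Integrable (fun T => (GaltonWatson.numAgreement a T : ℝ)) (GaltonWatson.pairLaw n) ∧
      ∫ T, (GaltonWatson.numAgreement a T : ℝ) ∂(GaltonWatson.pairLaw n) =
        (n.choose a : ℝ) / (2 ^ (a - 1) * ((2 * a - 3)‼ : ℝ))) ∧
    (∀ n : ℕ, 1 ≤ n →
      ∫ T, (GaltonWatson.numAgreement 1 T : ℝ) ∂(GaltonWatson.pairLaw n) = n ∧
      ∫ T, (GaltonWatson.numAgreement 2 T : ℝ) ∂(GaltonWatson.pairLaw n) =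
        (n : ℝ) * ((n : ℝ) - 1) / 4 ∧
      ∫ T, (GaltonWatson.numAgreement 3 T : ℝ) ∂(GaltonWatson.pairLaw n) =
        (n : ℝ) * ((n : ℝ) - 1) * ((n : ℝ) - 2) / 72) ∧
    ∃ δ : ℕ → ℝ, Tendsto δ atTop (𝓝 0) ∧
      Tendsto
        (fun n : ℕ => (GaltonWatson.pairLaw n).real
          {T | (GaltonWatson.mast T : ℝ) ≤ (1 + δ n) * (Real.exp 1 / 2) * Real.sqrt n})
        atTop (𝓝 1) := by
  have h : ∀ n a : ℕ, 1 ≤ n → 1 ≤ a →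
      ∫ T, (GaltonWatson.numAgreement a T : ℝ) ∂(GaltonWatson.pairLaw n) =
        (n.choose a : ℝ) / (2 ^ (a - 1) * ((2 * a - 3)‼ : ℝ)) := fun n a hn ha => by
    rw [GaltonWatson.integral_numAgreement hn ha, OrdTree.treeCount]
    push_cast
    rfl
  refine ⟨fun n a hn ha => ⟨GaltonWatson.integrable_numAgreement hn a, h n a hn ha⟩,
    fun n hn => ⟨?_, ?_, ?_⟩, fun n => (√√n)⁻¹,
    tendsto_inv_atTop_zero.comp GaltonWatson.tendsto_sqrt_sqrt_natCast,
    GaltonWatson.tendsto_real_mast_le⟩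
  · rw [h n 1 hn le_rfl]
    simp
  · rw [h n 2 hn (by omega), Nat.cast_choose_two]
    norm_num [Nat.doubleFactorial]
    ring
  · rw [h n 3 hn (by omega), Nat.cast_choose_eq_descPochhammer_div]
    norm_num [Nat.doubleFactorial, descPochhammer_succ_right, Nat.factorial]
    ring
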